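/- Let $K$ be a finite geometric simplicial complex in a finite-dimensional real vector space, with (closed) simplices $\Delta$ and geometric realization $|K|$. Each simplex $\Delta$ is regarded as a smooth manifold with corners. A complex of Lie algebroids on $K$ is a family $\underline{\mathcal A}=\{\mathcal A_\Delta\}_{\Delta\in K}$ in which $\mathcal A_\Delta$ is a (smooth, real, finite rank) transitive Lie algebroid on $\Delta$ and, whenever $\Delta'$ is a face of $\Delta$, the Lie algebroid restriction $(\mathcal A_\Delta)^{!!}_{\Delta'}$ (the inverse image of $\mathcal A_\Delta$ along $\Delta'\hookrightarrow\Delta$, with fibres $\rho^{-1}(T\Delta')$, $\rho$ the anchor) is $\mathcal A_{\Delta'}$, these identifications being compatible with iterated restriction. For $a\in|K|$ let $\Delta_a$ be the unique simplex of $K$ with $a$ in its interior, and let $\mathrm{St}\,a$ be the union of the interiors of all simplices of $K$ that contain $a$. An open set $U\subseteq|K|$ is regular if there are $a\in|K|$ and an open neighbourhood $Z$ of $a$ in $|K|$ with $U=Z\cap \mathrm{St}\,a$; the face $\Delta_a$ then depends only on $U$. The derived complex $\mathfrak A_U$ consists of the restrictions $(\mathcal A_\Delta)^{!!}_{U\cap\Delta}$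 for all $\Delta\in K$ that have $\Delta_a$ as a face. A piecewise smooth form of degree $p$ on $\mathfrak A_U$ is a family $(\omega_\Delta)$, indexed by these $\Delta$, where $\omega_\Delta$ is a smooth form of degree $p$ (a smooth section of $\Lambda^p$ of the dual bundle) on $(\mathcal A_\Delta)^{!!}_{U\cap\Delta}$, such that for all such $\Delta,\Delta'$ the restrictions of $\omega_\Delta$ and $\omega_{\Delta'}$ to $U\cap\Delta\cap\Delta'$, as forms on $(\mathcal A_{\Delta\cap\Delta'})^{!!}_{U\cap\Delta\cap\Delta'}$, coincide. These forms make up a real vector space $\Omega^p_{ps}(\mathfrak A_U)$. For regular open $V\subseteq U$ there is an obvious restriction map $\Omega^p_{ps}(\mathfrak A_U)\to\Omega^p_{ps}(\mathfrak A_V)$, so one has a presheaf on the base of regular open subsets of $|K|$. Let $\mathfrak S$ be the sheaf of real vector spaces on $|K|$ generated by this presheaf. **Theorem.** For every finite simplicial complex $K$, every complex of Lie algebroids $\underline{\mathcal A}$ on $K$ and every $p\ge 0$, the sheaf $\mathfrak S$ of the piecewise smooth forms of degree $p$ on $\underline{\mathcal A}$ is fine: for every locally finite open covering $\{U_j\}_{j\in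 J}$ of $|K|$ there are sheaf endomorphisms $\eta_j:\mathfrak S\to\mathfrak S$, $j\in J$, such that for each $j$ the map $\eta_j$ is zero on the stalks over some neighbourhood of $|K|\setminus U_j$, and $\sum_{j}\eta_j=\mathrm{id}_{\mathfrak S}$ (on each stalk a finite sum). -/

import Mathlib

open Set Filter Topology TopologicalSpace Manifold ContDiff

universe u

noncomputable section

namespace PiecewiseSmooth

section SimplexManifold

variable {E : Type u} [NormedAddCommGroup E] [NormedSpace ℝ E]

/-- The closed simplex with vertex set `s`, as a topological space (with the topology of `E`). -/
abbrev Simplex (s : Finset E) : Type u := ↥(convexHull ℝ (s : Set E))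

/-- The direction of the affine span of the vertices: the tangent space of the simplex. -/
abbrev Direction (s : Finset E) : Type u := ↥(vectorSpan ℝ (s : Set E))

variable {s : Finset E}

/-- The point `x` of the affine span of `s`, seen in the direction space through the choice of the
vertex `v` as origin. -/
def toDirection {v : E} (hv : v ∈ s) (x : Simplex s) : Direction s :=
  ⟨x.1 - v, by
    rw [← direction_affineSpan]
    exact AffineSubspace.vsub_mem_direction (convexHull_subset_affineSpan _ x.2)
      (subset_affineSpan _ _ hv)⟩

/-- The affine map from the direction space back to `E`. -/
def fromDirection (s : Finset E) (v : E) : Direction s →ᵃ[ℝ] E :=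
  (vectorSpan ℝ (s : Set E)).subtype.toAffineMap + AffineMap.const ℝ _ v

lemma fromDirection_apply (v : E) (w : Direction s) : fromDirection s v w = w.1 + v := rfl

lemma fromDirection_injective (v : E) : Function.Injective (fromDirection s v) := by
  intro a b h
  rw [fromDirection_apply, fromDirection_apply] at h
  exact Subtype.ext (add_right_cancel h)

/-- The vertices of the simplex form an affine basis of the direction space. -/
def directionBasis (hs : AffineIndependent ℝ ((↑) : s → E)) {v : E} (hv : v ∈ s) :
    AffineBasis s ℝ (Direction s) :=
  have ind : AffineIndependent ℝ
      (fun i : s => toDirection hv ⟨i.1, subset_convexHull ℝ _ i.2⟩) := by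
    apply AffineIndependent.of_comp (fromDirection s v)
    convert! hs using 1
    ext i
    simp [fromDirection_apply, toDirection]
  { toFun := fun i => toDirection hv ⟨i.1, subset_convexHull ℝ _ i.2⟩
    ind' := ind
    tot' := by
      have : Nonempty s := ⟨⟨v, hv⟩⟩
      have : FiniteDimensional ℝ (Direction s) :=
        finiteDimensional_vectorSpan_of_finite ℝ s.finite_toSet
      rw [ind.affineSpan_eq_top_iff_card_eq_finrank_add_one]
      have h1 : Set.range ((↑) : s → E) = (s : Set E) := by simp
      have h2 := hs.finrank_vectorSpan_add_one
      rw [h1] at h2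
      exact h2.symm }

lemma fromDirection_directionBasis (hs : AffineIndependent ℝ ((↑) : s → E)) {v : E} (hv : v ∈ s)
    (i : s) : fromDirection s v (directionBasis hs hv i) = i := by
  change (i.1 - v) + v = i
  simp

lemma fromDirection_toDirection {v : E} (hv : v ∈ s) (x : Simplex s) :
    fromDirection s v (toDirection hv x) = x := by
  change (x.1 - v) + v = x
  simp

lemma image_fromDirection (hs : AffineIndependent ℝ ((↑) : s → E)) {v : E} (hv : v ∈ s) :
    fromDirection s v '' convexHull ℝ (Set.range (directionBasis hs hv)) =
      convexHull ℝ (s : Set E) := by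
  rw [AffineMap.image_convexHull, ← Set.range_comp]
  congr 1
  ext x
  simp only [Set.mem_range, Function.comp_apply, fromDirection_directionBasis]
  simp

lemma mem_hull_iff (hs : AffineIndependent ℝ ((↑) : s → E)) {v : E} (hv : v ∈ s)
    (w : Direction s) : w ∈ convexHull ℝ (Set.range (directionBasis hs hv)) ↔
      fromDirection s v w ∈ convexHull ℝ (s : Set E) := by
  rw [← image_fromDirection hs hv, (fromDirection_injective v).mem_set_image]

/-- The barycentric coordinates of `w`, truncated to non-negative numbers. -/
def truncCoord (hs : AffineIndependent ℝ ((↑) : s → E)) {v : E} (hv : v ∈ s) (w : Direction s)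
    (i : s) : ℝ := max ((directionBasis hs hv).coord i w) 0

lemma truncCoord_sum_pos (hs : AffineIndependent ℝ ((↑) : s → E)) {v : E} (hv : v ∈ s)
    (w : Direction s) : 0 < ∑ i, truncCoord hs hv w i := by
  have h1 := (directionBasis hs hv).sum_coord_apply_eq_one w
  have h2 : ∑ i, (directionBasis hs hv).coord i w ≤ ∑ i, truncCoord hs hv w i :=
    Finset.sum_le_sum fun i _ => le_max_left _ _
  linarith

/-- A continuous retraction of the direction space onto the simplex: truncate the barycentric
coordinates and normalise. -/
def retractSimplex (hs : AffineIndependent ℝ ((↑) : s → E)) {v : E} (hv : v ∈ s)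
    (w : Direction s) : Simplex s :=
  ⟨Finset.univ.centerMass (truncCoord hs hv w) (fun i : s => (i : E)),
    Finset.centerMass_mem_convexHull _ (fun _ _ => le_max_right _ _)
      (truncCoord_sum_pos hs hv w) (fun i _ => i.2)⟩

lemma continuous_retractSimplex (hs : AffineIndependent ℝ ((↑) : s → E)) {v : E} (hv : v ∈ s) :
    Continuous (retractSimplex hs hv) := by
  have : FiniteDimensional ℝ (Direction s) :=
    finiteDimensional_vectorSpan_of_finite ℝ s.finite_toSet
  have hc : ∀ i, Continuous fun w => truncCoord hs hv w i := fun i =>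
    (continuous_barycentric_coord (directionBasis hs hv) i).max continuous_const
  refine Continuous.subtype_mk ?_ _
  unfold Finset.centerMass
  exact ((continuous_finsetSum _ fun i _ => hc i).inv₀
    fun w => (truncCoord_sum_pos hs hv w).ne').smul
    (continuous_finsetSum _ fun i _ => (hc i).smul continuous_const)

lemma retractSimplex_of_mem (hs : AffineIndependent ℝ ((↑) : s → E)) {v : E} (hv : v ∈ s)
    {w : Direction s} (hw : w ∈ convexHull ℝ (Set.range (directionBasis hs hv))) :
    (retractSimplex hs hv w : E) = fromDirection s v w := by
  have h0 : ∀ i, truncCoord hs hv w i = (directionBasis hs hv).coord i w := by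
    rw [(directionBasis hs hv).convexHull_eq_nonneg_coord] at hw
    exact fun i => max_eq_left (hw i)
  have h1 := (directionBasis hs hv).sum_coord_apply_eq_one w
  have h2 := (directionBasis hs hv).linear_combination_coord_eq_self w
  have h3 : (∑ i, (directionBasis hs hv).coord i w • ((i : E) - v)) = w.1 := by
    conv_rhs => rw [← h2]
    rw [Submodule.coe_sum]
    rfl
  change Finset.univ.centerMass (truncCoord hs hv w) (fun i : s => (i : E)) = w.1 + v
  rw [← h3]
  simp only [Finset.centerMass, h0, h1, inv_one, one_smul, smul_sub, Finset.sum_sub_distrib,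
    ← Finset.sum_smul]
  simp

/-- The closed simplex as a model with corners in the direction space of its affine span, through
the affine embedding `x ↦ x - v`, `v` a vertex. Hence a closed simplex is a manifold with corners
with a single chart, of the dimension of the simplex. -/
def simplexModel (s : Finset E) (hs : AffineIndependent ℝ ((↑) : s → E)) (hne : s.Nonempty) :
    ModelWithCorners ℝ (Direction s) (Simplex s) :=
  ModelWithCorners.ofConvexRange
    { toFun := toDirection hne.choose_spec
      invFun := retractSimplex hs hne.choose_spec
      source := univ
      target := convexHull ℝ (Set.range (directionBasis hs hne.choose_spec))
      map_source' := fun x _ => by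
        rw [mem_hull_iff, fromDirection_toDirection]
        exact x.2
      map_target' := fun _ _ => mem_univ _
      left_inv' := fun x _ => by
        apply Subtype.ext
        rw [retractSimplex_of_mem, fromDirection_toDirection]
        rw [mem_hull_iff, fromDirection_toDirection]
        exact x.2
      right_inv' := fun w hw => by
        apply fromDirection_injective hne.choose
        rw [fromDirection_toDirection, retractSimplex_of_mem _ _ hw] }
    rfl (convex_convexHull ℝ _)
    (Continuous.subtype_mk (continuous_subtype_val.sub continuous_const) _)
    (continuous_retractSimplex hs _)
    (by
      have : FiniteDimensional ℝ (Direction s) :=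
        finiteDimensional_vectorSpan_of_finite ℝ s.finite_toSet
      exact interior_convexHull_nonempty_iff_affineSpan_eq_top.2 (directionBasis hs _).tot)

end SimplexManifold
section LieAlgebroids

/-- A Lie algebroid on a manifold `M` (possibly with corners): a smooth vector bundle `Fiber` of
finite rank over `M`, a smooth vector bundle morphism `anchor` to the tangent bundle, and a real
Lie algebra structure on the space of smooth sections, such that the anchor induces a homomorphism
of Lie algebras to the vector fields and the Leibniz rule holds. -/
structure LieAlgebroid {V : Type u} [NormedAddCommGroup V] [NormedSpace ℝ V] {H : Type u}
    [TopologicalSpace H] (I : ModelWithCorners ℝ V H) (M : Type u) [TopologicalSpace M]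
    [ChartedSpace H M] [IsManifold I ∞ M] where
  /-- the model fibre -/
  F : Type u
  [normedF : NormedAddCommGroup F]
  [normedSpaceF : NormedSpace ℝ F]
  [finiteDimF : FiniteDimensional ℝ F]
  /-- the fibres -/
  Fiber : M → Type u
  [topTotal : TopologicalSpace (Bundle.TotalSpace F Fiber)]
  [topFiber : ∀ x, TopologicalSpace (Fiber x)]
  [addFiber : ∀ x, AddCommGroup (Fiber x)]
  [moduleFiber : ∀ x, Module ℝ (Fiber x)]
  [fiberBundle : FiberBundle F Fiber]
  [vectorBundle : VectorBundle ℝ F Fiber]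
  [smoothBundle : ContMDiffVectorBundle ∞ F Fiber I]
  /-- the anchor -/
  anchor : ∀ x, Fiber x →ₗ[ℝ] TangentSpace I x
  anchor_smooth : ContMDiff (I.prod 𝓘(ℝ, F)) I.tangent ∞
    (fun b : Bundle.TotalSpace F Fiber => (⟨b.1, anchor b.1 b.2⟩ : TangentBundle I M))
  /-- the bracket of smooth sections -/
  bracket : Cₛ^∞⟮I; F, Fiber⟯ →ₗ[ℝ] Cₛ^∞⟮I; F, Fiber⟯ →ₗ[ℝ] Cₛ^∞⟮I; F, Fiber⟯
  bracket_self : ∀ ξ, bracket ξ ξ = 0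
  jacobi : ∀ ξ η ζ, bracket ξ (bracket η ζ) = bracket (bracket ξ η) ζ + bracket η (bracket ξ ζ)
  anchor_bracket : ∀ (ξ η : Cₛ^∞⟮I; F, Fiber⟯) (x : M), anchor x (bracket ξ η x) =
    VectorField.mlieBracket I (fun y => anchor y (ξ y)) (fun y => anchor y (η y)) x
  leibniz : ∀ (ξ η : Cₛ^∞⟮I; F, Fiber⟯) (f : C^∞⟮I, M; ℝ⟯) (x : M),
    bracket ξ ⟨fun y => f y • η y, f.contMDiff.smul_section η.contMDiff⟩ x =
      f x • bracket ξ η x + mvfderiv I f x (anchor x (ξ x)) • η x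

attribute [instance] LieAlgebroid.normedF LieAlgebroid.normedSpaceF LieAlgebroid.finiteDimF
  LieAlgebroid.topTotal LieAlgebroid.topFiber LieAlgebroid.addFiber LieAlgebroid.moduleFiber
  LieAlgebroid.fiberBundle LieAlgebroid.vectorBundle LieAlgebroid.smoothBundle

variable {V : Type u} [NormedAddCommGroup V] [NormedSpace ℝ V] {H : Type u} [TopologicalSpace H]
  {I : ModelWithCorners ℝ V H} {M : Type u} [TopologicalSpace M] [ChartedSpace H M]
  [IsManifold I ∞ M]
  {V' : Type u} [NormedAddCommGroup V'] [NormedSpace ℝ V'] {H' : Type u} [TopologicalSpace H']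
  {J : ModelWithCorners ℝ V' H'} {N : Type u} [TopologicalSpace N] [ChartedSpace H' N]
  [IsManifold J ∞ N]

/-- A Lie algebroid is transitive if its anchor is surjective. -/
def LieAlgebroid.IsTransitive (A : LieAlgebroid I M) : Prop :=
  ∀ x, Function.Surjective (A.anchor x)

/-- An identification of the Lie algebroid `B` on the submanifold `φ : N ↪ M` with the Lie algebroid
restriction (inverse image along `φ`) of the transitive Lie algebroid `A`. The fibre of the
restriction at `x` is `{(X, a) ∈ T_x N × A_{φ x} | dφ X = ρ a}`, which the second projection
identifies with the subspace of `A_{φ x}` that the anchor maps into the tangent space of `N`, and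
its anchor is the first projection; the bracket of two sections of the restriction that are
restrictions of sections of `A` is the restriction of the bracket (on a face of a simplex every
section of `A` over the face extends to the simplex, so that this determines the bracket). -/
structure LieAlgebroid.Restriction (φ : N → M) (B : LieAlgebroid J N) (A : LieAlgebroid I M) where
  /-- the inclusion of the fibre of the restriction -/
  incl : ∀ x, B.Fiber x →ₗ[ℝ] A.Fiber (φ x)
  incl_smooth : ContMDiff (J.prod 𝓘(ℝ, B.F)) (I.prod 𝓘(ℝ, A.F)) ∞
    (fun b : Bundle.TotalSpace B.F B.Fiber =>
      (⟨φ b.1, incl b.1 b.2⟩ : Bundle.TotalSpace A.F A.Fiber))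
  incl_injective : ∀ x, Function.Injective (incl x)
  anchor_incl : ∀ x b, A.anchor (φ x) (incl x b) = mfderiv J I φ x (B.anchor x b)
  mem_range_incl : ∀ x a, a ∈ LinearMap.range (incl x) ↔
    ∃ X : TangentSpace J x, mfderiv J I φ x X = A.anchor (φ x) a
  bracket_incl : ∀ (ξ η : Cₛ^∞⟮I; A.F, A.Fiber⟯) (ξ' η' : Cₛ^∞⟮J; B.F, B.Fiber⟯),
    (∀ x, incl x (ξ' x) = ξ (φ x)) → (∀ x, incl x (η' x) = η (φ x)) →
    ∀ x, incl x (B.bracket ξ' η' x) = A.bracket ξ η (φ x)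

/-- Forms of degree `p` (not necessarily smooth) on the restriction of the Lie algebroid `A` to the
open subset `W` of `M`; since `W` is open, the fibres of that restriction are those of `A`. -/
abbrev LieAlgebroid.Form (A : LieAlgebroid I M) (W : Opens M) (p : ℕ) : Type u :=
  ∀ x : W, A.Fiber x.1 [⋀^Fin p]→ₗ[ℝ] ℝ

/-- A form on `W` is smooth if its values on smooth sections over open subsets of `W` are smooth
functions. -/
def LieAlgebroid.IsSmoothForm (A : LieAlgebroid I M) {W : Opens M} {p : ℕ} (θ : A.Form W p) :
    Prop :=
  ∀ (V : Opens M) (hV : V ≤ W) (ξ : Fin p → ∀ x : V, A.Fiber x.1),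
    (∀ i, ContMDiff I (I.prod 𝓘(ℝ, A.F)) ∞
      (fun x : V => (⟨x.1, ξ i x⟩ : Bundle.TotalSpace A.F A.Fiber))) →
    ContMDiff I 𝓘(ℝ, ℝ) ∞ (fun x : V => θ ⟨x.1, hV x.2⟩ (fun i => ξ i x))

/-- The real vector space of the smooth forms of degree `p` on the restriction of `A` to `W`. -/
def LieAlgebroid.smoothForms (A : LieAlgebroid I M) (W : Opens M) (p : ℕ) :
    Submodule ℝ (A.Form W p) where
  carrier := {θ | A.IsSmoothForm θ}
  zero_mem' := fun _ _ _ _ => contMDiff_const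
  add_mem' := fun h₁ h₂ V hV ξ hξ => (h₁ V hV ξ hξ).add (h₂ V hV ξ hξ)
  smul_mem' := fun c θ h V hV ξ hξ => by
    have h₁ : ContMDiff I 𝓘(ℝ, ℝ) ∞ (fun _ : V => c) := contMDiff_const
    exact h₁.smul (h V hV ξ hξ)

end LieAlgebroids

section Complexes

variable {E : Type u} [NormedAddCommGroup E] [NormedSpace ℝ E]

/-- The inclusion of a face of a simplex. -/
def faceInclusion {s t : Finset E} (h : s ⊆ t) : Simplex s → Simplex t :=
  Set.inclusion (convexHull_mono (Finset.coe_subset.2 h))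

/-- The manifold structure of the simplex `Δ` of `K`. -/
abbrev faceModel (K : Geometry.SimplicialComplex ℝ E) (Δ : K.faces) :
    ModelWithCorners ℝ (Direction Δ.1) (Simplex Δ.1) :=
  simplexModel Δ.1 (K.indep Δ.2) (K.nonempty_of_mem_faces Δ.2)

/-- A complex of Lie algebroids on the simplicial complex `K`: a transitive Lie algebroid on every
simplex of `K` such that the restriction of `A_t` to any face `s` of `t` is `A_s`; the
identifications of `A_s` with the restrictions are part of the data and are compatible with
iterated restriction. -/
structure LieAlgebroidComplex (K : Geometry.SimplicialComplex ℝ E) where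
  /-- the Lie algebroid on each simplex -/
  algebroid : ∀ Δ : K.faces, LieAlgebroid (faceModel K Δ) (Simplex Δ.1)
  transitive : ∀ Δ, (algebroid Δ).IsTransitive
  /-- the identification of `A_s` with the restriction of `A_t` to `s` -/
  restr : ∀ {s t : K.faces} (h : s.1 ⊆ t.1),
    LieAlgebroid.Restriction (faceInclusion h) (algebroid s) (algebroid t)
  restr_refl : ∀ (s : K.faces) (x : Simplex s.1) (a : (algebroid s).Fiber x),
    (restr (Finset.Subset.refl s.1)).incl x a = a
  restr_trans : ∀ {r s t : K.faces} (h₁ : r.1 ⊆ s.1) (h₂ : s.1 ⊆ t.1) (x : Simplex r.1)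
    (a : (algebroid r).Fiber x),
    (restr (h₁.trans h₂)).incl x a = (restr h₂).incl (faceInclusion h₁ x) ((restr h₁).incl x a)

end Complexes

section RegularOpens

variable {E : Type u} [NormedAddCommGroup E] [NormedSpace ℝ E]

/-- The interior of a simplex: the points that lie on no proper face. -/
def openSimplex (s : Finset E) : Set E :=
  {x | x ∈ convexHull ℝ (s : Set E) ∧ ∀ t ⊂ s, x ∉ convexHull ℝ (t : Set E)}

variable (K : Geometry.SimplicialComplex ℝ E)

/-- The generalized star of `a`: the union of the interiors of the simplices that contain `a`. -/
def generalizedStar (a : K.space) : Set K.space :=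
  {y | ∃ s ∈ K.faces, a.1 ∈ convexHull ℝ (s : Set E) ∧ y.1 ∈ openSimplex s}

/-- `U` is a regular open neighbourhood of `a`: the intersection of an open neighbourhood of `a`
in `|K|` with the generalized star of `a`. -/
def IsRegularNhd (U : Opens K.space) (a : K.space) : Prop :=
  ∃ Z : Opens K.space, a ∈ Z ∧ (U : Set K.space) = (Z : Set K.space) ∩ generalizedStar K a

/-- The regular open subsets of `|K|`, ordered by inclusion. -/
abbrev RegularOpen : Type u := {U : Opens K.space // ∃ a, IsRegularNhd K U a}

/-- The simplices that index the transverse family of `U`: those that have `Δ_a` as a face, where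
`U` is a regular open neighbourhood of `a` and `Δ_a` is the simplex with `a` in its interior. -/
def derivedSimplices (U : Opens K.space) : Set K.faces :=
  {Δ | ∃ a, IsRegularNhd K U a ∧ ∃ s ∈ K.faces, a.1 ∈ openSimplex s ∧ s ⊆ Δ.1}

variable {K}

lemma subset_of_mem_openSimplex {s t : Finset E} (hs : s ∈ K.faces) (ht : t ∈ K.faces) {x : E}
    (hx : x ∈ openSimplex s) (hx' : x ∈ convexHull ℝ (t : Set E)) : s ⊆ t := by
  classical
  by_contra h
  apply hx.2 (s ∩ t)
  · exact Finset.ssubset_iff_subset_ne.2 ⟨Finset.inter_subset_left,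
      fun e => h (Finset.inter_eq_left.1 e)⟩
  · have := K.inter_subset_convexHull hs ht ⟨hx.1, hx'⟩
    rwa [Finset.coe_inter]

lemma exists_mem_openSimplex (a : K.space) : ∃ s ∈ K.faces, a.1 ∈ openSimplex s := by
  obtain ⟨s, hs, ha⟩ := Geometry.SimplicialComplex.mem_space_iff.1 a.2
  have key : ∀ n : ℕ, ∀ s ∈ K.faces, s.card = n → a.1 ∈ convexHull ℝ (s : Set E) →
      ∃ s ∈ K.faces, a.1 ∈ openSimplex s := by
    intro n
    induction n using Nat.strong_induction_on with
    | _ n ih =>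
      intro s hs hn ha
      by_cases h : ∃ t ⊂ s, a.1 ∈ convexHull ℝ (t : Set E)
      · obtain ⟨t, hts, hat⟩ := h
        have hne : t.Nonempty := by
          rw [← Finset.coe_nonempty, ← convexHull_nonempty_iff (𝕜 := ℝ)]
          exact ⟨_, hat⟩
        exact ih t.card (hn ▸ Finset.card_lt_card hts) t (K.down_closed hs hts.1 hne) rfl hat
      · push Not at h
        exact ⟨s, hs, ha, h⟩
  exact key _ s hs rfl ha

lemma mem_generalizedStar_self (a : K.space) : a ∈ generalizedStar K a := by
  obtain ⟨s, hs, ha⟩ := exists_mem_openSimplex a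
  exact ⟨s, hs, ha.1, ha⟩

lemma isOpen_generalizedStar [Finite K.faces] (a : K.space) : IsOpen (generalizedStar K a) := by
  have h : (generalizedStar K a)ᶜ =
      ⋃ s ∈ {s ∈ K.faces | a.1 ∉ convexHull ℝ (s : Set E)},
        {y : K.space | y.1 ∈ convexHull ℝ (s : Set E)} := by
    ext y
    simp only [mem_compl_iff, mem_iUnion, mem_ofPred_eq, exists_prop]
    constructor
    · intro hy
      obtain ⟨s, hs, hys⟩ := exists_mem_openSimplex y
      exact ⟨s, ⟨hs, fun ha => hy ⟨s, hs, ha, hys⟩⟩, hys.1⟩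
    · rintro ⟨s, ⟨hs, has⟩, hys⟩ ⟨t, ht, hat, hyt⟩
      exact has (convexHull_mono (Finset.coe_subset.2 (subset_of_mem_openSimplex ht hs hyt hys))
        hat)
  rw [← isClosed_compl_iff, h]
  refine Set.Finite.isClosed_biUnion ((Set.toFinite K.faces).subset fun _ h => h.1) fun s _ => ?_
  exact ((s.finite_toSet.isCompact_convexHull ℝ).isClosed).preimage continuous_subtype_val

/-- The family of simplices does not depend on the centre of the regular open set. -/
lemma mem_derivedSimplices_iff {U : Opens K.space} {a : K.space} (ha : IsRegularNhd K U a)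
    {s : Finset E} (hs : s ∈ K.faces) (has : a.1 ∈ openSimplex s) (Δ : K.faces) :
    Δ ∈ derivedSimplices K U ↔ s ⊆ Δ.1 := by
  refine ⟨?_, fun h => ⟨a, ha, s, hs, has, h⟩⟩
  rintro ⟨b, ⟨Z', hbZ', hU'⟩, t, ht, hbt, htΔ⟩
  obtain ⟨Z, haZ, hU⟩ := ha
  have hb : b ∈ (U : Set K.space) := hU' ▸ ⟨hbZ', mem_generalizedStar_self b⟩
  rw [hU] at hb
  obtain ⟨r, hr, har, hbr⟩ := hb.2
  exact ((subset_of_mem_openSimplex hs hr has har).trans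
    (subset_of_mem_openSimplex hr ht hbr hbt.1)).trans htΔ

lemma derivedSimplices_mono {U V : RegularOpen K} (h : V ≤ U) {Δ : K.faces}
    (hΔ : Δ ∈ derivedSimplices K V.1) : Δ ∈ derivedSimplices K U.1 := by
  obtain ⟨b, ⟨Z', hbZ', hV⟩, t, ht, hbt, htΔ⟩ := hΔ
  obtain ⟨a, ha⟩ := U.2
  obtain ⟨s, hs, has⟩ := exists_mem_openSimplex a
  refine ⟨a, ha, s, hs, has, ?_⟩
  obtain ⟨Z, haZ, hU⟩ := ha
  have hb : b ∈ (V.1 : Set K.space) := hV ▸ ⟨hbZ', mem_generalizedStar_self b⟩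
  have hb' : b ∈ (U.1 : Set K.space) := h hb
  rw [hU] at hb'
  obtain ⟨r, hr, har, hbr⟩ := hb'.2
  exact ((subset_of_mem_openSimplex hs hr has har).trans
    (subset_of_mem_openSimplex hr ht hbr hbt.1)).trans htΔ

/-- The regular open sets form a base of the topology. -/
lemma exists_regularOpen_le [Finite K.faces] (W : Opens K.space) (x : K.space) (hx : x ∈ W) :
    ∃ U : RegularOpen K, x ∈ U.1 ∧ U.1 ≤ W :=
  ⟨⟨⟨(W : Set K.space) ∩ generalizedStar K x, W.2.inter (isOpen_generalizedStar x)⟩,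
    x, W, hx, rfl⟩, ⟨hx, mem_generalizedStar_self x⟩, fun _ hy => hy.1⟩

end RegularOpens

section Forms

variable {E : Type u} [NormedAddCommGroup E] [NormedSpace ℝ E] {K : Geometry.SimplicialComplex ℝ E}

/-- The inclusion of a simplex of `K` in `|K|`. -/
def simplexToSpace (Δ : K.faces) (x : Simplex Δ.1) : K.space :=
  ⟨x.1, K.convexHull_subset_space Δ.2 x.2⟩

/-- The open submanifold `Δ_U = U ∩ Δ` of the simplex `Δ`. -/
def simplexTrace (U : Opens K.space) (Δ : K.faces) : Opens (Simplex Δ.1) :=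
  ⟨{x | simplexToSpace Δ x ∈ U}, U.2.preimage (continuous_subtype_val.subtype_mk _)⟩

/-- A family of forms `θ_Δ` on the restrictions of the `A_Δ` to the manifolds `U ∩ Δ`, `Δ` running
through the family of simplices belonging to `U`, is a piecewise smooth form on the derived complex
of `A` corresponding to `U` if every `θ_Δ` is smooth and, for all `Δ`, `Δ'` in the family, with
`s = Δ ∩ Δ'`, the restrictions of `θ_Δ` and `θ_Δ'` to the restriction of `A_s` to `U ∩ s`
coincide. -/
structure IsPiecewiseSmooth (A : LieAlgebroidComplex K) {p : ℕ} {U : RegularOpen K}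
    (θ : ∀ Δ : derivedSimplices K U.1, (A.algebroid Δ.1).Form (simplexTrace U.1 Δ.1) p) :
    Prop where
  smooth : ∀ Δ, (A.algebroid Δ.1).IsSmoothForm (θ Δ)
  compatible : ∀ (Δ Δ' : derivedSimplices K U.1) (s : K.faces) (h : s.1 ⊆ Δ.1.1)
    (h' : s.1 ⊆ Δ'.1.1), (s.1 : Set E) = (Δ.1.1 : Set E) ∩ Δ'.1.1 →
    ∀ x : simplexTrace U.1 s,
      (θ Δ ⟨faceInclusion h x.1, x.2⟩).compLinearMap ((A.restr h).incl x.1) =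
        (θ Δ' ⟨faceInclusion h' x.1, x.2⟩).compLinearMap ((A.restr h').incl x.1)

/-- The real vector space of the piecewise smooth forms of degree `p` on the derived complex of `A`
corresponding to the regular open set `U`. -/
def piecewiseForms (A : LieAlgebroidComplex K) (p : ℕ) (U : RegularOpen K) :
    Submodule ℝ (∀ Δ : derivedSimplices K U.1,
      (A.algebroid Δ.1).Form (simplexTrace U.1 Δ.1) p) where
  carrier := {θ | IsPiecewiseSmooth A θ}
  zero_mem' :=
    { smooth := fun Δ => ((A.algebroid Δ.1).smoothForms (simplexTrace U.1 Δ.1) p).zero_mem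
      compatible := fun _ _ _ _ _ _ _ => rfl }
  add_mem' := fun {θ₁ θ₂} h₁ h₂ =>
    { smooth := fun Δ => ((A.algebroid Δ.1).smoothForms (simplexTrace U.1 Δ.1) p).add_mem
        (h₁.smooth Δ) (h₂.smooth Δ)
      compatible := fun Δ Δ' s h h' hs x => by
        have e₁ := h₁.compatible Δ Δ' s h h' hs x
        have e₂ := h₂.compatible Δ Δ' s h h' hs x
        simp only [Pi.add_apply, AlternatingMap.add_compLinearMap]
        rw [e₁, e₂] }
  smul_mem' := fun c θ hθ =>
    { smooth := fun Δ => ((A.algebroid Δ.1).smoothForms (simplexTrace U.1 Δ.1) p).smul_mem c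
        (hθ.smooth Δ)
      compatible := fun Δ Δ' s h h' hs x => by
        have e := hθ.compatible Δ Δ' s h h' hs x
        ext v
        exact congrArg (fun m => c • m v) e }

/-- The type of the piecewise smooth forms on the derived complex. -/
def PiecewiseForm (A : LieAlgebroidComplex K) (p : ℕ) (U : RegularOpen K) : Type u :=
  ↥(piecewiseForms A p U)

instance (A : LieAlgebroidComplex K) (p : ℕ) (U : RegularOpen K) :
    AddCommGroup (PiecewiseForm A p U) :=
  inferInstanceAs (AddCommGroup ↥(piecewiseForms A p U))

instance (A : LieAlgebroidComplex K) (p : ℕ) (U : RegularOpen K) :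
    Module ℝ (PiecewiseForm A p U) :=
  inferInstanceAs (Module ℝ ↥(piecewiseForms A p U))

/-- The restriction of piecewise smooth forms from `U` to `V ⊆ U`: every `θ_Δ` with `Δ` in the
family of simplices of `V` is restricted from `U ∩ Δ` to `V ∩ Δ`. -/
def restrictForms (A : LieAlgebroidComplex K) (p : ℕ) {U V : RegularOpen K} (h : V ≤ U) :
    PiecewiseForm A p U →ₗ[ℝ] PiecewiseForm A p V where
  toFun θ := ⟨fun Δ x => θ.1 ⟨Δ.1, derivedSimplices_mono h Δ.2⟩ ⟨x.1, h x.2⟩,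
    { smooth := fun Δ W hW ξ hξ => θ.2.smooth ⟨Δ.1, derivedSimplices_mono h Δ.2⟩ W
        (fun _ hy => h (hW hy)) ξ hξ
      compatible := fun Δ Δ' s hs hs' e x => θ.2.compatible ⟨Δ.1, derivedSimplices_mono h Δ.2⟩
        ⟨Δ'.1, derivedSimplices_mono h Δ'.2⟩ s hs hs' e ⟨x.1, h x.2⟩ }⟩
  map_add' _ _ := rfl
  map_smul' _ _ := rfl

lemma restrictForms_refl (A : LieAlgebroidComplex K) (p : ℕ) (U : RegularOpen K) :
    restrictForms A p (le_refl U) = LinearMap.id := rfl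

lemma restrictForms_trans (A : LieAlgebroidComplex K) (p : ℕ) {U V W : RegularOpen K}
    (h : V ≤ U) (h' : W ≤ V) :
    restrictForms A p (h'.trans h) = restrictForms A p h' ∘ₗ restrictForms A p h := rfl

/-- The regular open neighbourhoods of `x`, ordered by reverse inclusion. -/
abbrev RegularNhds (x : K.space) : Type u := {U : RegularOpen K // x ∈ U.1}ᵒᵈ

/-- The forms on a regular open neighbourhood of `x`. -/
abbrev nhdsForm (A : LieAlgebroidComplex K) (p : ℕ) (x : K.space) (U : RegularNhds x) : Type u :=
  PiecewiseForm A p (OrderDual.ofDual U).1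

/-- The restriction maps between regular open neighbourhoods of `x`. -/
def nhdsRestrict (A : LieAlgebroidComplex K) (p : ℕ) (x : K.space) (U V : RegularNhds x)
    (h : U ≤ V) : nhdsForm A p x U →ₗ[ℝ] nhdsForm A p x V :=
  restrictForms A p (OrderDual.ofDual_le_ofDual.2 h)

open Classical in
/-- The stalk at `x` of the presheaf `U ↦ PiecewiseForm A p U` on the base of regular open sets:
the direct limit over the regular open sets that contain `x`. -/
def Stalk (A : LieAlgebroidComplex K) (p : ℕ) (x : K.space) : Type u :=
  Module.DirectLimit (nhdsForm A p x) (nhdsRestrict A p x)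

open Classical in
instance (A : LieAlgebroidComplex K) (p : ℕ) (x : K.space) : AddCommGroup (Stalk A p x) :=
  Module.DirectLimit.addCommGroup (nhdsForm A p x) (nhdsRestrict A p x)

open Classical in
instance (A : LieAlgebroidComplex K) (p : ℕ) (x : K.space) : Module ℝ (Stalk A p x) :=
  Module.DirectLimit.module (nhdsForm A p x) (nhdsRestrict A p x)

open Classical in
/-- The germ at `x` of a piecewise smooth form on `U`. -/
def germ (A : LieAlgebroidComplex K) (p : ℕ) (U : RegularOpen K) (x : K.space) (hx : x ∈ U.1) :
    PiecewiseForm A p U →ₗ[ℝ] Stalk A p x :=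
  Module.DirectLimit.of ℝ (RegularNhds x) (nhdsForm A p x) (nhdsRestrict A p x)
    (OrderDual.toDual ⟨U, hx⟩)

lemma germ_restrictForms (A : LieAlgebroidComplex K) (p : ℕ) {U V : RegularOpen K} (h : V ≤ U)
    (x : K.space) (hx : x ∈ V.1) (θ : PiecewiseForm A p U) :
    germ A p V x hx (restrictForms A p h θ) = germ A p U x (h hx) θ := by
  classical
  exact Module.DirectLimit.of_f (R := ℝ) (ι := RegularNhds x)
    (G := nhdsForm A p x) (f := nhdsRestrict A p x)
    (i := OrderDual.toDual ⟨U, h hx⟩) (j := OrderDual.toDual ⟨V, hx⟩)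
    (hij := h) (x := θ)

/-- A family of germs over the open set `W` is a section of the generated sheaf if, locally on `W`,
it is the family of germs of a piecewise smooth form on a regular open set. -/
def IsSheafSection (A : LieAlgebroidComplex K) (p : ℕ) {W : Opens K.space}
    (σ : ∀ x : W, Stalk A p x.1) : Prop :=
  ∀ x : W, ∃ (U : RegularOpen K) (_ : x.1 ∈ U.1) (hU : U.1 ≤ W) (θ : PiecewiseForm A p U),
    ∀ y (hy : y ∈ U.1), σ ⟨y, hU hy⟩ = germ A p U y hy θ

lemma IsSheafSection.smul {A : LieAlgebroidComplex K} {p : ℕ} {W : Opens K.space}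
    (c : ℝ) {σ : ∀ x : W, Stalk A p x.1} (hσ : IsSheafSection A p σ) :
    IsSheafSection A p (fun x => c • σ x) := fun x => by
  obtain ⟨U, hx, hU, θ, hθ⟩ := hσ x
  refine ⟨U, hx, hU, c • θ, fun y hy => ?_⟩
  have e := (germ A p U y hy).map_smul c θ
  rw [← hθ y hy] at e
  exact e.symm

variable [Finite K.faces]

/-- Being a section of the generated sheaf is a local condition. -/
def sheafLocalPredicate (A : LieAlgebroidComplex K) (p : ℕ) :
    TopCat.LocalPredicate (X := TopCat.of K.space) (fun x => Stalk A p x) where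
  pred σ := IsSheafSection A p σ
  res {W W'} i σ hσ x := by
    obtain ⟨U, hx, hU, θ, hθ⟩ := hσ ⟨x.1, i.le x.2⟩
    obtain ⟨U', hx', hU'⟩ := exists_regularOpen_le (U.1 ⊓ W) x.1 ⟨hx, x.2⟩
    have hle : U' ≤ U := fun y hy => (hU' hy).1
    refine ⟨U', hx', fun y hy => (hU' hy).2, restrictForms A p hle θ, fun y hy => ?_⟩
    rw [germ_restrictForms]
    exact hθ y (hle hy)
  locality {W} σ h x := by
    obtain ⟨W', hx, i, hσ⟩ := h x
    obtain ⟨U, hx', hU, θ, hθ⟩ := hσ ⟨x.1, hx⟩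
    exact ⟨U, hx', fun y hy => i.le (hU hy), θ, hθ⟩

lemma IsSheafSection.zero (A : LieAlgebroidComplex K) (p : ℕ) (W : Opens K.space) :
    IsSheafSection A p (fun _ : W => 0) := fun x => by
  obtain ⟨U, hx, hU⟩ := exists_regularOpen_le W x.1 x.2
  exact ⟨U, hx, hU, 0, fun y hy => (LinearMap.map_zero (germ A p U y hy)).symm⟩

lemma IsSheafSection.add {A : LieAlgebroidComplex K} {p : ℕ} {W : Opens K.space}
    {σ τ : ∀ x : W, Stalk A p x.1} (hσ : IsSheafSection A p σ) (hτ : IsSheafSection A p τ) :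
    IsSheafSection A p (fun x => σ x + τ x) := fun x => by
  obtain ⟨U₁, hx₁, hU₁, θ₁, hθ₁⟩ := hσ x
  obtain ⟨U₂, hx₂, hU₂, θ₂, hθ₂⟩ := hτ x
  obtain ⟨U, hx, hU⟩ := exists_regularOpen_le (U₁.1 ⊓ U₂.1) x.1 ⟨hx₁, hx₂⟩
  have h₁ : U ≤ U₁ := fun y hy => (hU hy).1
  have h₂ : U ≤ U₂ := fun y hy => (hU hy).2
  refine ⟨U, hx, fun y hy => hU₁ (h₁ hy), restrictForms A p h₁ θ₁ + restrictForms A p h₂ θ₂,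
    fun y hy => ?_⟩
  have e := (germ A p U y hy).map_add (restrictForms A p h₁ θ₁) (restrictForms A p h₂ θ₂)
  rw [germ_restrictForms, germ_restrictForms, ← hθ₁ y (h₁ hy), ← hθ₂ y (h₂ hy)] at e
  exact e.symm

/-- The real vector space of the sections over `W` of the generated sheaf. -/
def sheafSections (A : LieAlgebroidComplex K) (p : ℕ) (W : Opens K.space) :
    Submodule ℝ (∀ x : W, Stalk A p x.1) where
  carrier := {σ | IsSheafSection A p σ}
  zero_mem' := IsSheafSection.zero A p W
  add_mem' := IsSheafSection.add
  smul_mem' := fun c _ => IsSheafSection.smul c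

/-- The presheaf of the sections of the generated sheaf. -/
def sheafPresheaf (A : LieAlgebroidComplex K) (p : ℕ) :
    TopCat.Presheaf (ModuleCat.{u} ℝ) (TopCat.of K.space) where
  obj W := ModuleCat.of ℝ (sheafSections A p W.unop)
  map i := ModuleCat.ofHom
    { toFun := fun σ => ⟨fun x => σ.1 ⟨x.1, i.unop.le x.2⟩,
        (sheafLocalPredicate A p).res i.unop σ.1 σ.2⟩
      map_add' := fun _ _ => rfl
      map_smul' := fun _ _ => rfl }

/-- The sheaf of the piecewise smooth forms of degree `p` on the complex of Lie algebroids `A`: the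
sheaf of real vector spaces on `|K|` generated by the presheaf `U ↦ PiecewiseForm A p U` on the
regular open subsets, i.e. the sheaf of sections of its space of germs. -/
def formSheaf (A : LieAlgebroidComplex K) (p : ℕ) :
    TopCat.Sheaf (ModuleCat.{u} ℝ) (TopCat.of K.space) :=
  ⟨sheafPresheaf A p,
    (TopCat.Presheaf.isSheaf_iff_isSheaf_comp (CategoryTheory.forget (ModuleCat.{u} ℝ)) _).2
      (TopCat.subsheafToTypes (sheafLocalPredicate A p)).2⟩

end Forms

section Fine

open CategoryTheory

/-- A sheaf of real vector spaces on a space `X` is fine if for every locally finite open covering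
`(U j)` of `X` there are endomorphisms `η j` of the sheaf such that `η j` vanishes on the stalks
over a neighbourhood of the complement of `U j`, and `∑ j, η j` is the identity (a sum that
is finite on every stalk). -/
def IsFine {X : TopCat.{u}} (S : TopCat.Sheaf (ModuleCat.{u} ℝ) X) : Prop :=
  ∀ (ι : Type u) (U : ι → Opens X), LocallyFinite (fun j => (U j : Set X)) → (⨆ j, U j) = ⊤ →
    ∃ η : ι → (S ⟶ S),
      (∀ j, ∃ W : Opens X, (U j : Set X)ᶜ ⊆ W ∧
        ∀ x ∈ W, (TopCat.Presheaf.stalkFunctor (ModuleCat.{u} ℝ) x).map (η j).hom = 0) ∧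
      ∀ x : X, ∑ᶠ j, (TopCat.Presheaf.stalkFunctor (ModuleCat.{u} ℝ) x).map (η j).hom =
        𝟙 (S.presheaf.stalk x)

end Fine

end PiecewiseSmooth

end

noncomputable section

namespace PiecewiseSmooth

open CategoryTheory

variable {E : Type u} [NormedAddCommGroup E] [NormedSpace ℝ E]

/-! The sheaf is a module over the smooth functions on the ambient space `E`, so a smooth partition
of unity on `E` gives the endomorphisms. A smooth function on `E` restricts to a smooth function on
every simplex (`contMDiff_simplex_coe`), and these restrictions agree on common faces. Multiplying a
piecewise smooth form by them therefore keeps both smoothness and compatibility (`mulForm`). The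
operation commutes with restriction, hence passes to germs (`mulStalk`) and to the generated sheaf
(`mulSheaf`).

On a stalk the action is additive in the function and depends only on its values on `|K|` near the
point (`mulSheafStalk_add`, `mulSheafStalk_congr`). Since `|K|` is closed in `E`, there is a
partition of unity on it subordinate to open sets of `E` that cut out the given covering. Each
member acts by zero off its closed support. Near a point of `|K|` only finitely many members matter
and their sum is 1, so the corresponding endomorphisms add up to the identity.

There are two notions of stalk: the direct limit `Stalk` over regular neighbourhoods, from which
sections are built, and the categorical stalk of `formSheaf`, in which fineness is stated. They are
never identified. Each identity is proved on `Stalk`, read off pointwise on sections, and carried to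
the categorical stalk by testing on germs of sections. -/

/-- In the single chart `x ↦ x - v` of the simplex the inclusion becomes the affine map `w ↦ w + v`.
-/
lemma contMDiff_simplex_coe {s : Finset E} (hs : AffineIndependent ℝ ((↑) : s → E))
    (hne : s.Nonempty) :
    ContMDiff (simplexModel s hs hne) 𝓘(ℝ, E) ∞ (fun x : Simplex s => (x : E)) := by
  have h : ContMDiff 𝓘(ℝ, Direction s) 𝓘(ℝ, E) ∞ (fromDirection s hne.choose) :=
    ((vectorSpan ℝ (s : Set E)).subtypeL.contDiff.add contDiff_const).contMDiff
  have e : (fun x : Simplex s => (x : E)) = fromDirection s hne.choose ∘ simplexModel s hs hne :=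
    funext fun x => (fromDirection_toDirection hne.choose_spec x).symm
  rw [e]
  exact h.comp (simplexModel s hs hne).contMDiff

variable {K : Geometry.SimplicialComplex ℝ E}

/-! ### Action of ambient smooth functions on piecewise smooth forms -/

/-- Multiplication of piecewise smooth forms by the restrictions of a smooth function on the
ambient space. -/
def mulForm (A : LieAlgebroidComplex K) (p : ℕ) (U : RegularOpen K) :
    C^∞⟮𝓘(ℝ, E), E; ℝ⟯ →ₗ[ℝ] Module.End ℝ (PiecewiseForm A p U) :=
  LinearMap.mk₂ ℝ
    (fun f θ => ⟨fun Δ x => f x.1.1 • θ.1 Δ x,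
      { smooth := fun Δ V hV ξ hξ =>
          ((f.contMDiff.comp (contMDiff_simplex_coe _ _)).comp contMDiff_subtype_val).smul
            (θ.2.smooth Δ V hV ξ hξ)
        -- The two face inclusions do not move `x` as a point of `E`, so both restrictions are
        -- scaled by the same number.
        compatible := fun Δ Δ' s h h' hs x => by
          ext v
          exact congrArg (fun m => f x.1.1 • m v) (θ.2.compatible Δ Δ' s h h' hs x) }⟩)
    (fun f g θ => Subtype.ext (funext₂ fun Δ x => add_smul (f x.1.1) (g x.1.1) (θ.1 Δ x)))
    (fun c f θ => Subtype.ext (funext₂ fun Δ x => mul_smul c (f x.1.1) (θ.1 Δ x)))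
    (fun f θ θ' => Subtype.ext (funext₂ fun Δ x => smul_add (f x.1.1) (θ.1 Δ x) (θ'.1 Δ x)))
    (fun c f θ => Subtype.ext (funext₂ fun Δ x => smul_comm (f x.1.1) c (θ.1 Δ x)))

lemma mulForm_one (A : LieAlgebroidComplex K) (p : ℕ) (U : RegularOpen K) :
    mulForm A p U 1 = LinearMap.id :=
  LinearMap.ext fun θ => Subtype.ext (funext₂ fun Δ x => one_smul ℝ (θ.1 Δ x))

lemma mulForm_congr (A : LieAlgebroidComplex K) (p : ℕ) {U : RegularOpen K}
    {f g : C^∞⟮𝓘(ℝ, E), E; ℝ⟯} (h : ∀ y ∈ U.1, f y.1 = g y.1) :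
    mulForm A p U f = mulForm A p U g :=
  LinearMap.ext fun θ => Subtype.ext (funext₂ fun Δ x =>
    congrArg (fun c : ℝ => c • θ.1 Δ x) (h (simplexToSpace Δ.1 x.1) x.2))

/-! ### Action on germs of piecewise smooth forms -/

lemma Stalk.hom_ext {A : LieAlgebroidComplex K} {p : ℕ} {x : K.space} {P : Type*}
    [AddCommGroup P] [Module ℝ P] {φ ψ : Stalk A p x →ₗ[ℝ] P}
    (h : ∀ U hx θ, φ (germ A p U x hx θ) = ψ (germ A p U x hx θ)) : φ = ψ := by
  classical
  exact Module.DirectLimit.hom_ext fun U => LinearMap.ext fun θ => h U.1 U.2 θ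

open Classical in
/-- Multiplication of germs of piecewise smooth forms by a smooth function. -/
def mulStalk (A : LieAlgebroidComplex K) (p : ℕ) (x : K.space) (f : C^∞⟮𝓘(ℝ, E), E; ℝ⟯) :
    Module.End ℝ (Stalk A p x) :=
  Module.DirectLimit.map (fun U : RegularNhds x => mulForm A p (OrderDual.ofDual U).1 f)
    -- Multiplication is pointwise, so it commutes definitionally with restriction to smaller
    -- regular sets.
    (fun _ _ _ => rfl)

lemma mulStalk_germ (A : LieAlgebroidComplex K) (p : ℕ) (U : RegularOpen K) (x : K.space)
    (hx : x ∈ U.1) (f : C^∞⟮𝓘(ℝ, E), E; ℝ⟯) (θ : PiecewiseForm A p U) :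
    mulStalk A p x f (germ A p U x hx θ) = germ A p U x hx (mulForm A p U f θ) := by
  classical
  exact Module.DirectLimit.map_apply_of (ι := RegularNhds x) (G := nhdsForm A p x)
    (G' := nhdsForm A p x) (i := OrderDual.toDual ⟨U, hx⟩) _ _ θ

lemma mulStalk_one (A : LieAlgebroidComplex K) (p : ℕ) (x : K.space) :
    mulStalk A p x 1 = LinearMap.id :=
  Stalk.hom_ext fun U hx θ => by rw [mulStalk_germ, mulForm_one]; rfl

lemma mulStalk_zero (A : LieAlgebroidComplex K) (p : ℕ) (x : K.space) :
    mulStalk A p x 0 = 0 :=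
  Stalk.hom_ext fun U hx θ => by
    rw [mulStalk_germ, map_zero]; exact map_zero (germ A p U x hx)

lemma mulStalk_add (A : LieAlgebroidComplex K) (p : ℕ) (x : K.space)
    (f g : C^∞⟮𝓘(ℝ, E), E; ℝ⟯) :
    mulStalk A p x (f + g) = mulStalk A p x f + mulStalk A p x g :=
  Stalk.hom_ext fun U hx θ => by
    rw [LinearMap.add_apply, mulStalk_germ, mulStalk_germ, mulStalk_germ, map_add]
    exact map_add (germ A p U x hx) _ _

variable [Finite K.faces]

/-- Regular sets form a base, so every germ at `x` is represented on a regular set inside `W`, where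
the two functions act alike. Finiteness of `K` enters here: it makes the generalized stars open. -/
lemma mulStalk_congr (A : LieAlgebroidComplex K) (p : ℕ) {W : Opens K.space}
    {f g : C^∞⟮𝓘(ℝ, E), E; ℝ⟯} (h : ∀ y ∈ W, f y.1 = g y.1) {x : K.space} (hx : x ∈ W) :
    mulStalk A p x f = mulStalk A p x g :=
  Stalk.hom_ext fun U hxU θ => by
    obtain ⟨U', hx', hU'⟩ := exists_regularOpen_le (U.1 ⊓ W) x ⟨hxU, hx⟩
    have hle : U' ≤ U := fun y hy => (hU' hy).1
    rw [← germ_restrictForms A p hle x hx' θ, mulStalk_germ, mulStalk_germ,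
      mulForm_congr A p fun y hy => h y (hU' hy).2]

/-! ### Action on the generated sheaf and on its categorical stalks -/

/-- Multiplication by a smooth function on the ambient space, as an endomorphism of the sheaf of
piecewise smooth forms. -/
def mulSheaf (A : LieAlgebroidComplex K) (p : ℕ) (f : C^∞⟮𝓘(ℝ, E), E; ℝ⟯) :
    formSheaf A p ⟶ formSheaf A p :=
  ⟨{ app := fun W => ModuleCat.ofHom
      { toFun := fun σ : sheafSections A p W.unop => (⟨fun x => mulStalk A p x.1 f (σ.1 x),
          fun x => by
            -- Where the section is the family of germs of `θ`, its multiple is the family of germs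
            -- of the multiple of `θ`.
            obtain ⟨U, hx, hU, θ, hθ⟩ := σ.2 x
            exact ⟨U, hx, hU, mulForm A p U f θ, fun y hy =>
              (congrArg (mulStalk A p y f) (hθ y hy)).trans (mulStalk_germ A p U y hy f θ)⟩⟩ :
          sheafSections A p W.unop)
        map_add' := fun σ τ => Subtype.ext (funext fun x => map_add (mulStalk A p x.1 f) _ _)
        map_smul' := fun c σ =>
          Subtype.ext (funext fun x => map_smul (mulStalk A p x.1 f) c (σ.1 x)) }
     naturality := fun _ _ _ => rfl }⟩

/-- The endomorphism of the categorical stalk of the sheaf given by a smooth function. -/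
abbrev mulSheafStalk (A : LieAlgebroidComplex K) (p : ℕ) (x : TopCat.of K.space)
    (f : C^∞⟮𝓘(ℝ, E), E; ℝ⟯) :
    (formSheaf A p).presheaf.stalk x ⟶ (formSheaf A p).presheaf.stalk x :=
  (TopCat.Presheaf.stalkFunctor (ModuleCat.{u} ℝ) x).map (mulSheaf A p f).hom

/-- Maps out of the categorical stalk are determined on germs of sections, so this formula reduces
the identities below to identities of `mulStalk` at each point. -/
lemma germ_mulSheafStalk (A : LieAlgebroidComplex K) (p : ℕ) {x : TopCat.of K.space}
    {W : Opens (TopCat.of K.space)} (hx : x ∈ W) (f : C^∞⟮𝓘(ℝ, E), E; ℝ⟯) :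
    (formSheaf A p).presheaf.germ W x hx ≫ mulSheafStalk A p x f =
      (mulSheaf A p f).hom.app (.op W) ≫ (formSheaf A p).presheaf.germ W x hx :=
  TopCat.Presheaf.stalkFunctor_map_germ W x hx (mulSheaf A p f).hom

/-- A section over `W'` has the same germ at `x` as its restriction to `W' ⊓ W`, and over that set
the two functions act identically. Both the vanishing off supports and the identity for the sum rest
on this locality. -/
lemma mulSheafStalk_congr (A : LieAlgebroidComplex K) (p : ℕ) {W : Opens (TopCat.of K.space)}
    {f g : C^∞⟮𝓘(ℝ, E), E; ℝ⟯} (h : ∀ y ∈ W, f y.1 = g y.1) {x : TopCat.of K.space}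
    (hx : x ∈ W) : mulSheafStalk A p x f = mulSheafStalk A p x g := by
  refine TopCat.Presheaf.stalk_hom_ext _ fun W' hx' => ?_
  have key : ∀ f : C^∞⟮𝓘(ℝ, E), E; ℝ⟯, (formSheaf A p).presheaf.germ W' x hx' ≫
      mulSheafStalk A p x f = (formSheaf A p).presheaf.map (homOfLE inf_le_left).op ≫
        (mulSheaf A p f).hom.app (.op (W' ⊓ W)) ≫
          (formSheaf A p).presheaf.germ (W' ⊓ W) x ⟨hx', hx⟩ := fun f => by
    rw [← TopCat.Presheaf.germ_res _ (homOfLE inf_le_left) x ⟨hx', hx⟩, Category.assoc]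
    exact congrArg (fun k => (formSheaf A p).presheaf.map (homOfLE inf_le_left).op ≫ k)
      (germ_mulSheafStalk A p (W := W' ⊓ W) ⟨hx', hx⟩ f)
  rw [key, key]
  congr 2
  ext σ
  exact Subtype.ext (funext fun y =>
    LinearMap.congr_fun (mulStalk_congr A p h y.2.2) (σ.1 y))

lemma mulSheafStalk_one (A : LieAlgebroidComplex K) (p : ℕ) (x : TopCat.of K.space) :
    mulSheafStalk A p x 1 = 𝟙 _ := by
  refine TopCat.Presheaf.stalk_hom_ext _ fun W hx => ?_
  rw [germ_mulSheafStalk, Category.comp_id]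
  convert Category.id_comp _
  ext σ
  exact Subtype.ext (funext fun y => LinearMap.congr_fun (mulStalk_one A p y.1) (σ.1 y))

lemma mulSheafStalk_zero (A : LieAlgebroidComplex K) (p : ℕ) (x : TopCat.of K.space) :
    mulSheafStalk A p x 0 = 0 := by
  refine TopCat.Presheaf.stalk_hom_ext _ fun W hx => ?_
  rw [germ_mulSheafStalk, Limits.comp_zero]
  convert Limits.zero_comp
  ext σ
  exact Subtype.ext (funext fun y => LinearMap.congr_fun (mulStalk_zero A p y.1) (σ.1 y))

lemma mulSheafStalk_add (A : LieAlgebroidComplex K) (p : ℕ) (x : TopCat.of K.space)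
    (f g : C^∞⟮𝓘(ℝ, E), E; ℝ⟯) :
    mulSheafStalk A p x (f + g) = mulSheafStalk A p x f + mulSheafStalk A p x g := by
  refine TopCat.Presheaf.stalk_hom_ext _ fun W hx => ?_
  rw [Preadditive.comp_add, germ_mulSheafStalk, germ_mulSheafStalk, germ_mulSheafStalk,
    ← Preadditive.add_comp]
  congr 1
  ext σ
  exact Subtype.ext (funext fun y => LinearMap.congr_fun (mulStalk_add A p y.1 f g) (σ.1 y))

lemma mulSheafStalk_sum (A : LieAlgebroidComplex K) (p : ℕ) (x : TopCat.of K.space) {ι : Type*}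
    (s : Finset ι) (f : ι → C^∞⟮𝓘(ℝ, E), E; ℝ⟯) :
    mulSheafStalk A p x (∑ j ∈ s, f j) = ∑ j ∈ s, mulSheafStalk A p x (f j) :=
  map_sum (AddMonoidHom.mk' (mulSheafStalk A p x) (mulSheafStalk_add A p x)) f s

/-! ### The partition of unity -/

lemma isClosed_space (K : Geometry.SimplicialComplex ℝ E) [Finite K.faces] :
    IsClosed K.space :=
  (Set.toFinite K.faces).isClosed_biUnion fun s _ =>
    (s.finite_toSet.isCompact_convexHull ℝ).isClosed

theorem isFine_formSheaf [FiniteDimensional ℝ E] (A : LieAlgebroidComplex K) (p : ℕ) :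
    IsFine (formSheaf A p) := by
  intro ι U _ hU
  -- The covering is extended to open sets of `E`, so that the partition of unity can be taken on a
  -- manifold.
  choose U' hU' using fun j => isOpen_induced_iff.1 (U j).2
  obtain ⟨ρ, hρ⟩ := SmoothPartitionOfUnity.exists_isSubordinate 𝓘(ℝ, E) (isClosed_space K) U'
    (fun j => (hU' j).1) fun x hx => by
      obtain ⟨j, hj⟩ := Opens.mem_iSup.1 (hU.ge (show (⟨x, hx⟩ : K.space) ∈ ⊤ from trivial))
      refine mem_iUnion_of_mem j ?_
      have hj' : (⟨x, hx⟩ : K.space) ∈ (U j : Set K.space) := hj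
      have e := (hU' j).2
      rw [show (U j).carrier = (U j : Set K.space) from rfl] at e
      rw [← e] at hj'
      exact hj'
  -- The closed support is needed: its complement is open, so `ρ j` is zero on a whole neighbourhood
  -- of `x` and not only at `x`.
  have vanish : ∀ j (x : K.space), x.1 ∉ tsupport (ρ j) → mulSheafStalk A p x (ρ j) = 0 :=
    fun j x hx => by
      rw [← mulSheafStalk_zero]
      exact mulSheafStalk_congr A p
        (W := ⟨_, (isClosed_tsupport (ρ j)).isOpen_compl.preimage continuous_subtype_val⟩)
        (fun y hy => image_eq_zero_of_notMem_tsupport hy) hx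
  -- The neighbourhood of the complement of `U j` is the complement of the closed support of `ρ j`,
  -- since that support lies in `U' j`.
  refine ⟨fun j => mulSheaf A p (ρ j), fun j => ⟨⟨_,
    (isClosed_tsupport (ρ j)).isOpen_compl.preimage continuous_subtype_val⟩,
    fun x hx hx' => hx ?_, fun x hx => vanish j x hx⟩, fun x => ?_⟩
  · have e := (hU' j).2
    rw [show (U j).carrier = (U j : Set K.space) from rfl] at e
    rw [← e]
    exact hρ j hx'
  -- The closed supports are also locally finite. One finite index set then serves every point of
  -- `N'`, and `vanish` applies to the remaining indices.
  · obtain ⟨N, hN, hfin⟩ := ρ.locallyFinite.closure x.1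
    obtain ⟨N', hN', hoN, hxN⟩ := mem_nhds_iff.1 hN
    have hsub : ∀ y ∈ N', ∀ j, y ∈ tsupport (ρ j) → j ∈ hfin.toFinset := fun y hy j hj =>
      hfin.mem_toFinset.2 ⟨y, hj, hN' hy⟩
    rw [finsum_eq_sum_of_support_subset (s := hfin.toFinset)]
    -- The finite sum of the `ρ j` is known to be 1 only on `N' ∩ |K|`; by locality this is enough
    -- for it to act as 1 on the stalk.
    · refine (mulSheafStalk_sum A p x hfin.toFinset fun j => ρ j).symm.trans
        (Eq.trans ?_ (mulSheafStalk_one A p x))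
      refine mulSheafStalk_congr A p (W := ⟨_, hoN.preimage continuous_subtype_val⟩)
        (fun y hy => ?_) hxN
      have h1 := ρ.sum_eq_one y.2
      rw [finsum_eq_sum_of_support_subset (s := hfin.toFinset)] at h1
      -- Evaluation at `y` is a ring homomorphism, which turns the sum of functions into the sum of
      -- their values.
      · exact (map_sum (ContMDiffMap.evalRingHom (n := ∞) (I := 𝓘(ℝ, E)) (I' := 𝓘(ℝ, ℝ))
          (R := ℝ) y.1) _ _).trans h1
      · exact fun j hj => hsub _ hy j (subset_tsupport _ hj)
    · intro j hj
      by_contra hj'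
      exact hj (vanish j x fun hxj => hj' (hsub _ hxN j hxj))

end PiecewiseSmooth

end

theorem mainTheorem1 {E : Type u} [NormedAddCommGroup E] [NormedSpace ℝ E] [FiniteDimensional ℝ E]
    (K : Geometry.SimplicialComplex ℝ E) [Finite K.faces]
    (A : PiecewiseSmooth.LieAlgebroidComplex K) (p : ℕ) :
    PiecewiseSmooth.IsFine (PiecewiseSmooth.formSheaf A p) :=
  PiecewiseSmooth.isFine_formSheaf A p
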